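/- Let $n \ge 4$ and let $F_n$ be the free group with basis $x_1, \dots, x_n$. For a group $G$ write $G^{\mathrm{ab}}$ for its abelianization, and let $\mathrm{IA}(G)$ be the group of automorphisms of $G$ that act trivially on $G^{\mathrm{ab}}$. Put $H = F_n^{\mathrm{ab}}$ and $\mathrm{IA}_n = \mathrm{IA}(F_n)$. Let $\mathcal{K}_n \subset \mathrm{IA}_n$ be the kernel of the Magnus representation of $\mathrm{IA}_n$, that is, the group of those $\varphi \in \mathrm{IA}_n$ for which the matrix $\big(\partial \varphi(x_i)/\partial x_j\big)_{1 \le i,j \le n}$ of Fox derivatives becomes the identity matrix after projecting its entries from $\mathbb{Z}[F_n]$ to $\mathbb{Z}[H]$. For $d \ge 2$ let $W_{n,d} \subset F_n$ be the kernel of the homomorphism from $F_n$ to a cyclic group of order $d$ that sends $x_1$ to a generator and $x_2, \dots, x_n$ to $1$. Since $W_{n,d} \supset [F_n, F_n]$, every $\varphi \in \mathrm{IA}_n$ restricts to an automorphism of $W_{n,d}$. If $\varphi \in \mathcal{K}_n$, this restriction lies in $\mathrm{IA}(W_{n,d})$, so restriction induces a homomorphism $\mathcal{K}_n^{\mathrm{ab}}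 \to \mathrm{IA}(W_{n,d})^{\mathrm{ab}}$. Let $\iota_i \in \mathrm{IA}_n$ be the inner automorphism $x \mapsto x_i x x_i^{-1}$, let $[a,b] = a b a^{-1} b^{-1}$, and set $$\sigma = [[\iota_2, \iota_3], [\iota_2, \iota_4]] \in \mathrm{IA}_n,$$ where automorphisms are composed so that $\sigma(x) = [[x_2,x_3],[x_2,x_4]]\, x\, [[x_2,x_3],[x_2,x_4]]^{-1}$ for all $x \in F_n$. Then $\sigma \in \mathcal{K}_n$, and the class of $\sigma$ in $\mathcal{K}_n^{\mathrm{ab}}$ is nonzero; but for every $d \ge 2$ its image in $\mathrm{IA}(W_{n,d})^{\mathrm{ab}}$ is zero. In particular, the homomorphisms $\mathcal{K}_n^{\mathrm{ab}} \to \mathrm{IA}(W_{n,d})^{\mathrm{ab}}$, $d \ge 2$, do not together detect all of $\mathcal{K}_n^{\mathrm{ab}}$. -/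

import Mathlib

open scoped BigOperators commutatorElement

noncomputable section

namespace Kouko

/-! ### IA-automorphism groups -/

/-- `IA(G)`: the automorphisms of `G` that act trivially on the abelianization `G^ab`. -/
def IA (G : Type*) [Group G] : Subgroup (MulAut G) where
  carrier := {φ | ∀ x : G, Abelianization.of (φ x) = Abelianization.of x}
  one_mem' := fun _ => rfl
  mul_mem' := by
    intro φ ψ hφ hψ x
    rw [MulAut.mul_apply, hφ, hψ]
  inv_mem' := by
    intro φ hφ x
    have h := hφ (φ⁻¹ x)
    rw [MulAut.apply_inv_self] at h
    exact h.symm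

theorem mul_inv_mem_commutator {G : Type*} [Group G] {φ : MulAut G} (hφ : φ ∈ IA G) (x : G) :
    φ x * x⁻¹ ∈ commutator G := by
  rw [← Abelianization.ker_of, MonoidHom.mem_ker, map_mul, hφ x, map_inv, mul_inv_cancel]

theorem apply_mem {G : Type*} [Group G] {N : Subgroup G} (hN : commutator G ≤ N)
    {φ : MulAut G} (hφ : φ ∈ IA G) {x : G} (hx : x ∈ N) : φ x ∈ N := by
  have h := N.mul_mem (hN (mul_inv_mem_commutator hφ x)) hx
  rwa [inv_mul_cancel_right] at h

/-- The action of `IA(G)` on a subgroup `N` that contains `[G, G]`, by restriction. -/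
def restrict {G : Type*} [Group G] (N : Subgroup G) (hN : commutator G ≤ N) :
    IA G →* MulAut N where
  toFun φ :=
    { toFun := fun x => ⟨φ.1 x, apply_mem hN φ.2 x.2⟩
      invFun := fun x => ⟨φ.1⁻¹ x, apply_mem hN ((IA G).inv_mem φ.2) x.2⟩
      left_inv := fun x => Subtype.ext (MulAut.inv_apply_self G φ.1 x)
      right_inv := fun x => Subtype.ext (MulAut.apply_inv_self G φ.1 x)
      map_mul' := fun x y => Subtype.ext (map_mul φ.1 (x : G) y) }
  map_one' := rfl
  map_mul' _ _ := rfl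

/-! ### The free group, Fox derivatives and the Magnus representation -/

/-- The free group `F_n`; its basis `x_1, …, x_n` is `FreeGroup.of 0, …, FreeGroup.of (n - 1)`. -/
abbrev F (n : ℕ) : Type := FreeGroup (Fin n)

/-- `H`, the abelianization of `F_n`, written multiplicatively. -/
abbrev H (n : ℕ) : Type := Abelianization (F n)

/-- `IA_n`. -/
abbrev IAn (n : ℕ) : Subgroup (MulAut (F n)) := IA (F n)

/-- The sum `∑_j ε_j δ_{μ_j,i} x_{μ_1}^{ε_1} ⋯ x_{μ_j}^{(ε_j - 1)/2}` in `ℤ[F_n]` attached to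
the word `x_{μ_1}^{ε_1} ⋯ x_{μ_r}^{ε_r}`; a letter is a pair `(μ, b)` with `b = true` for `ε = 1`
and `b = false` for `ε = -1`. The first letter contributes `δ` or `-δ x⁻¹`, and every other
term starts with the first letter. -/
def foxWord {n : ℕ} (i : Fin n) : List (Fin n × Bool) → MonoidAlgebra ℤ (F n)
  | [] => 0
  | p :: L =>
    (if p.1 = i then
      (if p.2 = true then 1 else -MonoidAlgebra.of ℤ (F n) (FreeGroup.of p.1)⁻¹) else 0)
      + MonoidAlgebra.of ℤ (F n) (FreeGroup.mk [p]) * foxWord i L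

/-- The Fox derivative `∂w/∂x_i` of an element `w` of `F_n`, computed on its reduced word. -/
def fox {n : ℕ} (i : Fin n) (w : F n) : MonoidAlgebra ℤ (F n) := foxWord i w.toWord

theorem foxWord_append {n : ℕ} (i : Fin n) (L M : List (Fin n × Bool)) :
    foxWord i (L ++ M) =
      foxWord i L + MonoidAlgebra.of ℤ (F n) (FreeGroup.mk L) * foxWord i M := by
  induction L with
  | nil =>
    have h : (FreeGroup.mk [] : F n) = 1 := rfl
    rw [List.nil_append, foxWord, h, map_one, one_mul, zero_add]
  | cons p L ih =>
    have h : (FreeGroup.mk (p :: L) : F n) = FreeGroup.mk [p] * FreeGroup.mk L := rfl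
    rw [List.cons_append, foxWord, ih, foxWord, h, map_mul, mul_add, mul_assoc, add_assoc]

theorem foxWord_step {n : ℕ} (i : Fin n) {L M : List (Fin n × Bool)}
    (h : FreeGroup.Red.Step L M) : foxWord i L = foxWord i M := by
  cases h with
  | @not L₁ L₂ x b =>
    rw [foxWord_append, foxWord_append]
    congr 2
    have e : (FreeGroup.mk [(x, b)] : F n) * FreeGroup.mk [(x, !b)] = 1 := by
      cases b <;> exact Quot.sound (@FreeGroup.Red.Step.not _ [] [] x _)
    have e1 : (FreeGroup.mk [(x, true)] : F n) = FreeGroup.of x := rfl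
    have e2 : (FreeGroup.mk [(x, false)] : F n) = (FreeGroup.of x)⁻¹ := rfl
    rw [foxWord, foxWord, mul_add, ← mul_assoc, ← map_mul, e, map_one, one_mul, ← add_assoc]
    convert zero_add _ using 2
    by_cases hx : x = i
    · subst hx
      cases b
      · simp only [if_true, Bool.false_eq_true, if_false, Bool.not_false, e2, mul_one]
        exact neg_add_cancel _
      · simp only [if_true, Bool.not_true, Bool.false_eq_true, if_false, e1, mul_neg, ← map_mul,
          mul_inv_cancel, map_one]
        exact add_neg_cancel _
    · simp [hx]

theorem foxWord_red {n : ℕ} (i : Fin n) {L M : List (Fin n × Bool)}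
    (h : FreeGroup.Red L M) : foxWord i L = foxWord i M := by
  induction h with
  | refl => rfl
  | tail _ h ih => exact ih.trans (foxWord_step i h)

theorem fox_mul {n : ℕ} (i : Fin n) (u v : F n) :
    fox i (u * v) = fox i u + MonoidAlgebra.of ℤ (F n) u * fox i v := by
  have h : FreeGroup.Red (u.toWord ++ v.toWord) (u * v).toWord := by
    have e : u * v = FreeGroup.mk (u.toWord ++ v.toWord) := by
      rw [← FreeGroup.mul_mk, FreeGroup.mk_toWord, FreeGroup.mk_toWord]
    rw [e, FreeGroup.toWord_mk]
    exact FreeGroup.reduce.red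
  rw [fox, ← foxWord_red i h, foxWord_append, FreeGroup.mk_toWord]
  rfl

theorem fox_of {n : ℕ} (i j : Fin n) : fox i (FreeGroup.of j) = if j = i then 1 else 0 := by
  simp [fox, foxWord, FreeGroup.toWord_of]

theorem fox_one {n : ℕ} (i : Fin n) : fox i (1 : F n) = 0 := by
  simp [fox, foxWord]

/-- The ring homomorphism `𝔞 : ℤ[F_n] → ℤ[H]` induced by the abelianization. -/
def abRing (n : ℕ) : MonoidAlgebra ℤ (F n) →+* MonoidAlgebra ℤ (H n) :=
  MonoidAlgebra.mapDomainRingHom ℤ Abelianization.of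

/-- The image `(∂w/∂x_j)^𝔞` of the Fox derivative in `ℤ[H]`. -/
def foxAb {n : ℕ} (j : Fin n) (w : F n) : MonoidAlgebra ℤ (H n) := abRing n (fox j w)

/-- The class of an element of `F_n` as an element of `ℤ[H]`. -/
def cls {n : ℕ} (w : F n) : MonoidAlgebra ℤ (H n) :=
  MonoidAlgebra.of ℤ (H n) (Abelianization.of w)

/-- The Magnus matrix `((∂ (x_i^φ) / ∂x_j)^𝔞)_{i,j}` of an automorphism `φ` of `F_n`. -/
def magnusMatrix {n : ℕ} (φ : MulAut (F n)) :
    Matrix (Fin n) (Fin n) (MonoidAlgebra ℤ (H n)) :=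
  Matrix.of fun i j => foxAb j (φ (FreeGroup.of i))

theorem foxAb_mul {n : ℕ} (i : Fin n) (u v : F n) :
    foxAb i (u * v) = foxAb i u + cls u * foxAb i v := by
  have h : abRing n (MonoidAlgebra.of ℤ (F n) u) = cls u := by
    simp [abRing, cls]
  rw [foxAb, fox_mul, map_add, map_mul, h, foxAb, foxAb]

theorem foxAb_of {n : ℕ} (i j : Fin n) :
    foxAb i (FreeGroup.of j) = if j = i then 1 else 0 := by
  rw [foxAb, fox_of]; split_ifs <;> simp

theorem foxAb_one {n : ℕ} (i : Fin n) : foxAb i (1 : F n) = 0 := by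
  rw [foxAb, fox_one, map_zero]

theorem cls_mul {n : ℕ} (u v : F n) : cls (u * v) = cls u * cls v := by
  simp [cls]

theorem foxAb_inv {n : ℕ} (i : Fin n) (u : F n) :
    foxAb i u⁻¹ = -(cls u⁻¹ * foxAb i u) := by
  have h := foxAb_mul i u⁻¹ u
  rw [inv_mul_cancel, foxAb_one] at h
  exact eq_neg_of_add_eq_zero_left h.symm

theorem foxAb_apply {n : ℕ} {φ : MulAut (F n)} (hφ : φ ∈ IAn n) (j : Fin n) (w : F n) :
    foxAb j (φ w) = ∑ i, foxAb i w * foxAb j (φ (FreeGroup.of i)) := by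
  have hc : ∀ u : F n, cls (φ u) = cls u := fun u => by rw [cls, hφ u, cls]
  induction w using FreeGroup.induction_on with
  | C1 => simp [foxAb_one]
  | of x => simp [foxAb_of]
  | inv_of x ih =>
    rw [map_inv, foxAb_inv, ← map_inv, hc, ih, Finset.mul_sum, ← Finset.sum_neg_distrib]
    refine Finset.sum_congr rfl fun i _ => ?_
    rw [foxAb_inv, neg_mul, mul_assoc]
  | mul u v hu hv =>
    rw [map_mul, foxAb_mul, hu, hv, hc, Finset.mul_sum, ← Finset.sum_add_distrib]
    refine Finset.sum_congr rfl fun i _ => ?_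
    rw [foxAb_mul, add_mul, mul_assoc]

/-- The Magnus representation of `IA_n`. Automorphisms are composed from right to left here, so it
is a homomorphism to the opposite of the matrix ring; for the right action of `Aut F_n` on `F_n`
it is a homomorphism to the matrix ring itself. The kernel is the same. -/
def magnusRep (n : ℕ) :
    IAn n →* (Matrix (Fin n) (Fin n) (MonoidAlgebra ℤ (H n)))ᵐᵒᵖ where
  toFun φ := MulOpposite.op (magnusMatrix φ.1)
  map_one' := by
    rw [MulOpposite.op_eq_one_iff]
    ext1 i j
    simp [magnusMatrix, foxAb_of, Matrix.one_apply]
  map_mul' := by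
    intro φ ψ
    rw [← MulOpposite.op_mul]
    congr 1
    ext1 i j
    rw [Matrix.mul_apply]
    exact foxAb_apply φ.2 j (ψ.1 (FreeGroup.of i))

/-- `K_n`, the kernel of the Magnus representation of `IA_n`. -/
def K (n : ℕ) : Subgroup (IAn n) := (magnusRep n).ker

/-! ### The subgroups `W_{n,d}` -/

/-- The homomorphism from `F_n` to the cyclic group of order `d` that sends `x_1` to a
generator and every other `x_i` to `1`. -/
def toCyclic (n d : ℕ) : F n →* Multiplicative (ZMod d) :=
  FreeGroup.lift fun i => if i.val = 0 then Multiplicative.ofAdd 1 else 1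

/-- `W_{n,d}`. -/
def W (n d : ℕ) : Subgroup (F n) := (toCyclic n d).ker

theorem commutator_le_W (n d : ℕ) : commutator (F n) ≤ W n d :=
  Abelianization.commutator_subset_ker _

/-- The action `ρ_{n,d} : IA_n → Aut W_{n,d}`. -/
def rho (n d : ℕ) : IAn n →* MulAut (W n d) := restrict (W n d) (commutator_le_W n d)

/-! ### `K_n` acts on `W_{n,d}` by IA-automorphisms -/

theorem of_surj (n : ℕ) : Function.Surjective (Abelianization.of : F n →* H n) :=
  QuotientGroup.mk'_surjective _

/-- A representative in `F_n` of a class in `H`. -/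
def sec {n : ℕ} (h : H n) : F n := Function.surjInv (of_surj n) h

theorem of_sec {n : ℕ} (h : H n) : Abelianization.of (sec h) = h :=
  Function.surjInv_eq (of_surj n) h

theorem loop_mem {n d : ℕ} (h : H n) (u : F n) :
    sec h * u * (sec (h * Abelianization.of u))⁻¹ ∈ W n d := by
  apply commutator_le_W
  rw [← Abelianization.ker_of, MonoidHom.mem_ker]
  simp [of_sec]

/-- The class in `W_{n,d}^ab` of the loop at the base point that reads `u` from the vertex `h`. -/
def loop {n : ℕ} (d : ℕ) (h : H n) (u : F n) : Additive (Abelianization (W n d)) :=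
  Additive.ofMul (Abelianization.of ⟨_, loop_mem (d := d) h u⟩)

theorem loop_mul {n d : ℕ} (h : H n) (u v : F n) :
    loop d h (u * v) = loop d h u + loop d (h * Abelianization.of u) v := by
  rw [loop, loop, loop, ← ofMul_mul, ← map_mul]
  congr 2
  ext1
  simp only [Subgroup.coe_mul, map_mul, mul_assoc]
  group

theorem loop_one {n d : ℕ} (h : H n) : loop d h (1 : F n) = 0 := by
  have := loop_mul (d := d) h 1 1
  rw [map_one, mul_one, mul_one] at this
  exact left_eq_add.mp this

/-- The additive map on `ℤ[H]` that sends the vertex `h` to the edge loop of `x_i` from `h`. -/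
def edge {n : ℕ} (d : ℕ) (i : Fin n) :
    MonoidAlgebra ℤ (H n) →+ Additive (Abelianization (W n d)) :=
  (Finsupp.liftAddHom fun h : H n =>
    (zmultiplesHom (Additive (Abelianization (W n d)))) (loop d h (FreeGroup.of i))).comp
    (MonoidAlgebra.coeffAddEquiv (R := ℤ) (M := H n)).toAddMonoidHom

theorem edge_of {n : ℕ} (d : ℕ) (i : Fin n) (h : H n) :
    edge d i (MonoidAlgebra.of ℤ (H n) h) = loop d h (FreeGroup.of i) := by
  simp [edge]

theorem loop_eq {n : ℕ} (d : ℕ) (u : F n) : ∀ h : H n,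
    loop d h u = ∑ i, edge d i (MonoidAlgebra.of ℤ (H n) h * foxAb i u) := by
  induction u using FreeGroup.induction_on with
  | C1 => intro h; simp [loop_one, foxAb_one]
  | of x =>
    intro h
    rw [Finset.sum_eq_single x]
    · rw [foxAb_of, if_pos rfl, mul_one, edge_of]
    · intro i _ hi
      rw [foxAb_of, if_neg hi.symm, mul_zero, map_zero]
    · simp
  | inv_of x _ =>
    intro h
    have e := loop_mul (d := d) h (FreeGroup.of x)⁻¹ (FreeGroup.of x)
    rw [inv_mul_cancel, loop_one] at e
    rw [eq_neg_of_add_eq_zero_left e.symm, Finset.sum_eq_single x]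
    · rw [foxAb_inv, foxAb_of, if_pos rfl, mul_one, cls, mul_neg, map_neg, ← map_mul, edge_of]
    · intro i _ hi
      rw [foxAb_inv, foxAb_of, if_neg hi.symm, mul_zero, neg_zero, mul_zero, map_zero]
    · simp
  | mul u v hu hv =>
    intro h
    rw [loop_mul, hu, hv, ← Finset.sum_add_distrib]
    refine Finset.sum_congr rfl fun i _ => ?_
    rw [foxAb_mul, mul_add, map_add, cls, map_mul (MonoidAlgebra.of ℤ (H n)), mul_assoc]

theorem rho_mem_IA {n : ℕ} (d : ℕ) {φ : IAn n} (hφ : φ ∈ K n) : rho n d φ ∈ IA (W n d) := by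
  intro w
  have hm : magnusMatrix φ.1 = 1 := MulOpposite.op_injective hφ
  have hx : ∀ i j, foxAb j (φ.1 (FreeGroup.of i)) = if i = j then 1 else 0 := fun i j => by
    have := congrFun (congrFun hm i) j
    rwa [Matrix.one_apply] at this
  have hw : ∀ j, foxAb j (φ.1 w.1) = foxAb j w.1 := fun j => by
    rw [foxAb_apply φ.2]
    simp [hx]
  have hl : loop d 1 (φ.1 w.1) = loop d 1 w.1 := by
    rw [loop_eq, loop_eq]
    simp only [hw]
  have hs : sec (1 : H n) ∈ W n d := by
    apply commutator_le_W
    rw [← Abelianization.ker_of, MonoidHom.mem_ker, of_sec]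
  have hi : Abelianization.of (φ.1 w.1) = Abelianization.of w.1 := φ.2 w.1
  have ht : sec (1 * Abelianization.of w.1) ∈ W n d := by
    have := (W n d).mul_mem ((W n d).inv_mem (loop_mem (d := d) 1 w.1))
      ((W n d).mul_mem hs w.2)
    simpa [mul_assoc] using this
  have key : ∀ v : W n d, Abelianization.of v.1 = Abelianization.of w.1 →
      loop d 1 v.1 = Additive.ofMul (Abelianization.of (⟨_, hs⟩ : W n d) * Abelianization.of v *
        (Abelianization.of (⟨_, ht⟩ : W n d))⁻¹) := by
    intro v hv
    rw [loop, ← map_mul, ← map_inv, ← map_mul]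
    congr 2
    ext1
    simp [hv]
  have h1 := key (rho n d φ w) hi
  have h2 := key w rfl
  have h3 := h1.symm.trans (hl.trans h2)
  exact mul_left_cancel (mul_right_cancel (Additive.ofMul.injective h3))

/-- The homomorphism `K_n → IA(W_{n,d})` induced by `ρ_{n,d}`. -/
def KtoIA (n d : ℕ) : K n →* IA (W n d) :=
  ((rho n d).comp (K n).subtype).codRestrict (IA (W n d)) fun φ => rho_mem_IA d φ.2

/-- The induced homomorphism `K_n^ab → IA(W_{n,d})^ab`. -/
def abKtoIA (n d : ℕ) : Abelianization (K n) →* Abelianization (IA (W n d)) :=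
  Abelianization.map (KtoIA n d)

/-! ### The element `σ` -/

/-- The inner automorphism `x ↦ x_i x x_i⁻¹`, where `x_i` is the basis element with (zero-based)
index `i`. -/
def iota {n : ℕ} (i : Fin n) : IAn n :=
  ⟨MulAut.conj (FreeGroup.of i), fun x => by simp [MulAut.conj_apply, mul_comm]⟩

/-- `σ = [[ι_2, ι_3], [ι_2, ι_4]]` with `[a, b] = a b a⁻¹ b⁻¹`; the basis elements `x_2, x_3, x_4`
have the zero-based indices `1, 2, 3`. -/
def sigma (n : ℕ) (hn : 4 ≤ n) : IAn n :=
  ⁅⁅iota (⟨1, by omega⟩ : Fin n), iota (⟨2, by omega⟩ : Fin n)⁆,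
    ⁅iota (⟨1, by omega⟩ : Fin n), iota (⟨3, by omega⟩ : Fin n)⁆⁆

end Kouko

end

open scoped BigOperators commutatorElement

noncomputable section

namespace Kouko

/-! ### The Magnus theorem: the Fox derivatives in `ℤ[H]` detect `F_n''` inside `F_n'` -/

/-! Write F' and F'' for the first two derived subgroups of F = `F n`. Nonvanishing: by Magnus, an
element of F' lies in F'' once its Fox derivatives vanish in ℤ[H] (`mem_second_derived_of_foxAb`),
so φ ∈ K_n moves each x by an element φ(x)x⁻¹ of F''. Modulo [F', F''] the group F'' is central in
F', and φ fixes F'' pointwise (`map_apply_eq`); hence φ ↦ φ(x)x⁻¹ is a homomorphism from K_n to the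
abelian group F''/[F', F'']. A triangular matrix representation killing [F', F''] shows that it does
not vanish on σ for x = x_1. Vanishing: x_2, x_3, x_4 lie in W_{n,d}, so ι_2, ι_3, ι_4 restrict to
inner automorphisms of W_{n,d}, which belong to IA(W_{n,d}). The image of σ is therefore a
commutator there. -/

theorem mem_commutator_iff {n : ℕ} {u : F n} :
    u ∈ commutator (F n) ↔ Abelianization.of u = 1 := by
  rw [← Abelianization.ker_of, MonoidHom.mem_ker]

theorem cls_eq_one {n : ℕ} {u : F n} (hu : u ∈ commutator (F n)) : cls u = 1 := by
  rw [cls, mem_commutator_iff.1 hu, map_one]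

theorem derivedLoop_mem {n : ℕ} (h : H n) (u : F n) :
    sec h * u * (sec (h * Abelianization.of u))⁻¹ ∈ commutator (F n) := by
  rw [mem_commutator_iff]
  simp [of_sec]

/-- The class in the abelianization of `[F_n, F_n]` of the loop that reads `u` from the
vertex `h`. -/
def derivedLoop {n : ℕ} (h : H n) (u : F n) : Additive (Abelianization (commutator (F n))) :=
  Additive.ofMul (Abelianization.of ⟨_, derivedLoop_mem h u⟩)

/-- Concatenation of paths in the Cayley graph of H: the two copies of the chosen representative at
the intermediate vertex cancel. -/
theorem derivedLoop_mul {n : ℕ} (h : H n) (u v : F n) :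
    derivedLoop h (u * v) = derivedLoop h u + derivedLoop (h * Abelianization.of u) v := by
  rw [derivedLoop, derivedLoop, derivedLoop, ← ofMul_mul, ← map_mul]
  congr 2
  ext1
  simp only [Subgroup.coe_mul, map_mul, mul_assoc]
  group

theorem derivedLoop_one {n : ℕ} (h : H n) : derivedLoop h (1 : F n) = 0 := by
  have := derivedLoop_mul h 1 1
  rw [map_one, mul_one, mul_one] at this
  exact left_eq_add.mp this

/-- The additive map on `ℤ[H]` that sends the vertex `h` to the edge loop of `x_i` from `h`. -/
def derivedEdge {n : ℕ} (i : Fin n) :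
    MonoidAlgebra ℤ (H n) →+ Additive (Abelianization (commutator (F n))) :=
  (Finsupp.liftAddHom fun h : H n =>
    (zmultiplesHom (Additive (Abelianization (commutator (F n)))))
      (derivedLoop h (FreeGroup.of i))).comp
    (MonoidAlgebra.coeffAddEquiv (R := ℤ) (M := H n)).toAddMonoidHom

theorem derivedEdge_of {n : ℕ} (i : Fin n) (h : H n) :
    derivedEdge i (MonoidAlgebra.of ℤ (H n) h) = derivedLoop h (FreeGroup.of i) := by
  simp [derivedEdge]

/-- The Fox derivatives in ℤ[H] count, with signs, the edges that the lifted path traverses, so they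
determine its class in the abelianization of F'. -/
theorem derivedLoop_eq {n : ℕ} (u : F n) : ∀ h : H n,
    derivedLoop h u = ∑ i, derivedEdge i (MonoidAlgebra.of ℤ (H n) h * foxAb i u) := by
  induction u using FreeGroup.induction_on with
  | C1 => intro h; simp [derivedLoop_one, foxAb_one]
  | of x =>
    intro h
    rw [Finset.sum_eq_single x]
    · rw [foxAb_of, if_pos rfl, mul_one, derivedEdge_of]
    · intro i _ hi
      rw [foxAb_of, if_neg hi.symm, mul_zero, map_zero]
    · simp
  | inv_of x _ =>
    intro h
    have e := derivedLoop_mul h (FreeGroup.of x)⁻¹ (FreeGroup.of x)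
    rw [inv_mul_cancel, derivedLoop_one] at e
    rw [eq_neg_of_add_eq_zero_left e.symm, Finset.sum_eq_single x]
    · rw [foxAb_inv, foxAb_of, if_pos rfl, mul_one, cls, mul_neg, map_neg, ← map_mul,
        derivedEdge_of]
    · intro i _ hi
      rw [foxAb_inv, foxAb_of, if_neg hi.symm, mul_zero, neg_zero, mul_zero, map_zero]
    · simp
  | mul u v hu hv =>
    intro h
    rw [derivedLoop_mul, hu, hv, ← Finset.sum_add_distrib]
    refine Finset.sum_congr rfl fun i _ => ?_
    rw [foxAb_mul, mul_add, map_add, cls, map_mul (MonoidAlgebra.of ℤ (H n)), mul_assoc]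

theorem mem_second_derived_of_foxAb {n : ℕ} {w : F n} (hw : w ∈ commutator (F n))
    (h : ∀ j, foxAb j w = 0) : w ∈ ⁅commutator (F n), commutator (F n)⁆ := by
  have hl : derivedLoop 1 w = 0 := by
    rw [derivedLoop_eq]
    simp [h]
  -- The representative of 1 ∈ H need not be 1, but it lies in F', so conjugating by it is harmless
  -- in the abelianization.
  have hs : sec (1 : H n) ∈ commutator (F n) := by
    rw [mem_commutator_iff, of_sec]
  have e : derivedLoop 1 w = Additive.ofMul
      (Abelianization.of (⟨_, hs⟩ : commutator (F n)) * Abelianization.of ⟨w, hw⟩ *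
        (Abelianization.of (⟨_, hs⟩ : commutator (F n)))⁻¹) := by
    rw [derivedLoop, ← map_mul, ← map_inv, ← map_mul]
    congr 2
    ext1
    simp [mem_commutator_iff.1 hw]
  rw [e, mul_inv_cancel_comm] at hl
  have hm : (⟨w, hw⟩ : commutator (F n)) ∈ commutator (commutator (F n)) :=
    (QuotientGroup.eq_one_iff _).1 hl
  have := Subgroup.mem_map_of_mem (commutator (F n)).subtype hm
  rwa [map_commutator_eq, Subgroup.range_subtype] at this

/-- On F' the factor `cls u` is 1, so the product rule makes `foxAb j` a homomorphism to an abelian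
group. -/
theorem foxAb_eq_zero {n : ℕ} (j : Fin n) {w : F n}
    (hw : w ∈ ⁅commutator (F n), commutator (F n)⁆) : foxAb j w = 0 := by
  let g : commutator (F n) →* Multiplicative (MonoidAlgebra ℤ (H n)) :=
    { toFun := fun u => Multiplicative.ofAdd (foxAb j u.1)
      map_one' := by simp [foxAb_one]
      map_mul' := fun u v => by
        simp [foxAb_mul, cls_eq_one u.2] }
  rw [← Subgroup.range_subtype (commutator (F n)), ← map_commutator_eq] at hw
  obtain ⟨u, hu, rfl⟩ := hw
  exact Abelianization.commutator_subset_ker g hu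

theorem mem_K_iff {n : ℕ} {φ : IAn n} :
    φ ∈ K n ↔ ∀ i j, foxAb j (φ.1 (FreeGroup.of i)) = if i = j then 1 else 0 := by
  rw [K, MonoidHom.mem_ker]
  change MulOpposite.op (magnusMatrix φ.1) = 1 ↔ _
  rw [MulOpposite.op_eq_one_iff, ← Matrix.ext_iff]
  simp [magnusMatrix, Matrix.one_apply]

theorem mul_inv_mem_of_mem_K {n : ℕ} {φ : IAn n} (hφ : φ ∈ K n) (x : F n) :
    φ.1 x * x⁻¹ ∈ ⁅commutator (F n), commutator (F n)⁆ := by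
  refine mem_second_derived_of_foxAb (mul_inv_mem_commutator φ.2 x) fun j => ?_
  have h : foxAb j (φ.1 x) = foxAb j x := by
    rw [foxAb_apply φ.2]
    simp [mem_K_iff.1 hφ]
  have hc := cls_eq_one (mul_inv_mem_commutator φ.2 x)
  rw [cls_mul] at hc
  rw [foxAb_mul, foxAb_inv, mul_neg, ← mul_assoc, hc, h, one_mul, add_neg_cancel]

/-! ### A homomorphism on `K_n` attached to a representation of `F_n / [F_n', F_n'']` -/


/-- For a, b ∈ F', φ multiplies a and b by elements of F'', whose images commute with f(F') and so
drop out of f([a, b]). -/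
theorem map_apply_eq {n : ℕ} {P : Type*} [Group P] {f : F n →* P}
    (hf : ∀ a ∈ commutator (F n), ∀ b ∈ ⁅commutator (F n), commutator (F n)⁆,
      Commute (f a) (f b))
    {φ : IAn n} (hφ : φ ∈ K n) {w : F n} (hw : w ∈ ⁅commutator (F n), commutator (F n)⁆) :
    f (φ.1 w) = f w := by
  suffices h : ⁅commutator (F n), commutator (F n)⁆ ≤
      (f.comp φ.1.toMonoidHom).eqLocus f from h hw
  rw [Subgroup.commutator_le]
  intro a ha b hb
  have key : ∀ x, ∃ m ∈ ⁅commutator (F n), commutator (F n)⁆, φ.1 x = m * x := fun x =>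
    ⟨_, mul_inv_mem_of_mem_K hφ x, by group⟩
  obtain ⟨p, hp, ep⟩ := key a
  obtain ⟨q, hq, eq⟩ := key b
  have hle : ⁅commutator (F n), commutator (F n)⁆ ≤ commutator (F n) :=
    Subgroup.commutator_le_right _ _
  change f (φ.1 ⁅a, b⁆) = f ⁅a, b⁆
  rw [map_commutatorElement, map_commutatorElement, map_commutatorElement, ep, eq,
    map_mul, map_mul]
  have h1 : Commute (f a) (f p) := hf a ha p hp
  have h2 : Commute (f a) (f q) := hf a ha q hq
  have h3 : Commute (f b) (f p) := hf b hb p hp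
  have h4 : Commute (f b) (f q) := hf b hb q hq
  have h5 : Commute (f p) (f q) := hf p (hle hp) q hq
  have h6 : Commute (f p) (f q * f b) := h5.mul_right h3.symm
  have h7 : Commute (f q) (f p * f a) := h5.symm.mul_right h2.symm
  rw [commutatorElement_def, commutatorElement_def, mul_inv_rev, mul_inv_rev]
  calc f p * f a * (f q * f b) * ((f a)⁻¹ * (f p)⁻¹) * ((f b)⁻¹ * (f q)⁻¹)
      = f p * (f a * f q) * f b * (f a)⁻¹ * ((f p)⁻¹ * (f b)⁻¹) * (f q)⁻¹ := by
        simp only [mul_assoc]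
    _ = (f p * f q) * f a * (f b * (f a)⁻¹ * (f b)⁻¹) * (f p)⁻¹ * (f q)⁻¹ := by
        rw [h2.eq, (h3.symm.inv_inv).eq]; simp only [mul_assoc]
    _ = f p * f q * (f a * f b * (f a)⁻¹ * (f b)⁻¹) * (f p * f q)⁻¹ := by
        rw [h5.eq]; simp only [mul_assoc, mul_inv_rev]
    _ = f a * f b * (f a)⁻¹ * (f b)⁻¹ := by
        have hc : Commute (f p * f q) (f a * f b * (f a)⁻¹ * (f b)⁻¹) := by
          have ha' : Commute (f p * f q) (f a) := (h1.mul_right h2).symm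
          have hb' : Commute (f p * f q) (f b) := (h3.mul_right h4).symm
          exact ((ha'.mul_right hb').mul_right ha'.inv_right).mul_right hb'.inv_right
        rw [hc.eq, mul_inv_cancel_right]

/-- The homomorphism `φ ↦ f (φ(x) x⁻¹)` on `K_n`, for `f` that kills `[F_n', F_n'']`. -/
def displacement {n : ℕ} {P : Type*} [Group P] (f : F n →* P)
    (hf : ∀ a ∈ commutator (F n), ∀ b ∈ ⁅commutator (F n), commutator (F n)⁆,
      Commute (f a) (f b)) (x : F n) : K n →* P where
  toFun φ := f (φ.1.1 x * x⁻¹)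
  map_one' := by simp
  map_mul' φ ψ := by
    have hψ := mul_inv_mem_of_mem_K ψ.2 x
    have hφ := mul_inv_mem_of_mem_K φ.2 x
    -- The cocycle identity; under f the outer φ disappears by `map_apply_eq`, and the two factors
    -- commute.
    have e : (φ * ψ).1.1 x * x⁻¹ = φ.1.1 (ψ.1.1 x * x⁻¹) * (φ.1.1 x * x⁻¹) := by
      simp
    rw [e, map_mul f, map_apply_eq hf φ.2 hψ]
    exact hf _ (mul_inv_mem_commutator ψ.1.2 x) _ hφ

theorem displacement_apply {n : ℕ} {P : Type*} [Group P] {f : F n →* P}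
    (hf : ∀ a ∈ commutator (F n), ∀ b ∈ ⁅commutator (F n), commutator (F n)⁆,
      Commute (f a) (f b)) (x : F n) (φ : K n) :
    displacement f hf x φ = f (φ.1.1 x * x⁻¹) := rfl

/-- P need not be abelian, but the values lie in f(F''), whose elements commute with one another. -/
theorem displacement_eq_one {n : ℕ} {P : Type*} [Group P] {f : F n →* P}
    (hf : ∀ a ∈ commutator (F n), ∀ b ∈ ⁅commutator (F n), commutator (F n)⁆,
      Commute (f a) (f b)) (x : F n) {φ : K n} (hφ : Abelianization.of φ = 1) :
    displacement f hf x φ = 1 := by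
  rw [← MonoidHom.mem_ker, Abelianization.ker_of] at hφ
  suffices h : commutator (K n) ≤ (displacement f hf x).ker from h hφ
  rw [commutator_def, Subgroup.commutator_le]
  intro φ _ ψ _
  rw [MonoidHom.mem_ker, map_commutatorElement, commutatorElement_eq_one_iff_mul_comm]
  exact hf _ (mul_inv_mem_commutator φ.1.2 x) _ (mul_inv_mem_of_mem_K ψ.2 x)

/-! ### Upper triangular `3 × 3` matrices -/

/-- The rational upper triangular matrices with diagonal `(p, q, 1)`, entries `x`, `y` above the
diagonal and `z` in the corner. -/
@[ext]
structure Borel where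
  p : ℚˣ
  q : ℚˣ
  x : ℚ
  y : ℚ
  z : ℚ

namespace Borel

instance : Mul Borel :=
  ⟨fun a b => ⟨a.p * b.p, a.q * b.q, a.p * b.x + a.x * b.q, a.q * b.y + a.y,
    a.p * b.z + a.x * b.y + a.z⟩⟩

instance : One Borel := ⟨⟨1, 1, 0, 0, 0⟩⟩

instance : Inv Borel :=
  ⟨fun a => ⟨a.p⁻¹, a.q⁻¹, -(a.x / (a.p * a.q)), -(a.y / a.q),
    (a.x * a.y / a.q - a.z) / a.p⟩⟩

@[simp] theorem mul_p (a b : Borel) : (a * b).p = a.p * b.p := rfl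
@[simp] theorem mul_q (a b : Borel) : (a * b).q = a.q * b.q := rfl
@[simp] theorem mul_x (a b : Borel) : (a * b).x = a.p * b.x + a.x * b.q := rfl
@[simp] theorem mul_y (a b : Borel) : (a * b).y = a.q * b.y + a.y := rfl
@[simp] theorem mul_z (a b : Borel) : (a * b).z = a.p * b.z + a.x * b.y + a.z := rfl
@[simp] theorem one_p : (1 : Borel).p = 1 := rfl
@[simp] theorem one_q : (1 : Borel).q = 1 := rfl
@[simp] theorem one_x : (1 : Borel).x = 0 := rfl
@[simp] theorem one_y : (1 : Borel).y = 0 := rfl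
@[simp] theorem one_z : (1 : Borel).z = 0 := rfl
@[simp] theorem inv_p (a : Borel) : a⁻¹.p = a.p⁻¹ := rfl
@[simp] theorem inv_q (a : Borel) : a⁻¹.q = a.q⁻¹ := rfl
@[simp] theorem inv_x (a : Borel) : a⁻¹.x = -(a.x / (a.p * a.q)) := rfl
@[simp] theorem inv_y (a : Borel) : a⁻¹.y = -(a.y / a.q) := rfl
@[simp] theorem inv_z (a : Borel) : a⁻¹.z = (a.x * a.y / a.q - a.z) / a.p := rfl

instance : Group Borel :=
  Group.ofLeftAxioms
    (fun a b c => by ext <;> simp <;> ring)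
    (fun a => by ext <;> simp)
    (fun a => by
      have hp := a.p.ne_zero
      have hq := a.q.ne_zero
      ext <;> simp <;> field_simp <;> ring)

/-- The diagonal of a matrix. -/
def diag : Borel →* ℚˣ × ℚˣ where
  toFun a := (a.p, a.q)
  map_one' := rfl
  map_mul' _ _ := rfl

theorem diag_of_mem {a : Borel} (ha : a ∈ commutator Borel) : a.p = 1 ∧ a.q = 1 :=
  Prod.ext_iff.1 (Abelianization.commutator_subset_ker diag ha)

/-- The central matrices among the unitriangular ones. -/
def corner : Subgroup Borel where
  carrier := {a | a.p = 1 ∧ a.q = 1 ∧ a.x = 0 ∧ a.y = 0}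
  one_mem' := by simp
  mul_mem' := by
    rintro a b ⟨h1, h2, h3, h4⟩ ⟨k1, k2, k3, k4⟩
    simp [*]
  inv_mem' := by
    rintro a ⟨h1, h2, h3, h4⟩
    simp [*]

/-- Commutators in `Borel` are unitriangular, and on unitriangular matrices the entries `x` and `y`
are additive. -/
theorem second_derived_le : ⁅commutator Borel, commutator Borel⁆ ≤ corner := by
  rw [Subgroup.commutator_le]
  intro a ha b hb
  obtain ⟨h1, h2⟩ := diag_of_mem ha
  obtain ⟨k1, k2⟩ := diag_of_mem hb
  refine ⟨?_, ?_, ?_, ?_⟩ <;> simp [commutatorElement_def, *]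

theorem commute_of_mem {a b : Borel} (ha : a ∈ commutator Borel)
    (hb : b ∈ ⁅commutator Borel, commutator Borel⁆) : Commute a b := by
  obtain ⟨h1, h2⟩ := diag_of_mem ha
  obtain ⟨k1, k2, k3, k4⟩ := second_derived_le hb
  ext <;> simp [*, add_comm]

theorem commute_map {G : Type*} [Group G] (f : G →* Borel) :
    ∀ a ∈ commutator G, ∀ b ∈ ⁅commutator G, commutator G⁆, Commute (f a) (f b) := by
  have h : (commutator G).map f ≤ commutator Borel := by
    rw [map_commutator_eq, commutator_def]
    exact Subgroup.commutator_mono le_top le_top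
  intro a ha b hb
  refine commute_of_mem (h (Subgroup.mem_map_of_mem f ha)) ?_
  have hb' := Subgroup.mem_map_of_mem f hb
  rw [Subgroup.map_commutator] at hb'
  exact Subgroup.commutator_mono h h hb'

/-- `x_1` and `x_2` go to diagonal matrices, `x_3` and `x_4` to elementary ones. -/
def rep (n : ℕ) : F n →* Borel :=
  FreeGroup.lift fun i =>
    -- Any nonzero scalar other than 1 would serve in place of each 2.
    if i.val = 0 then ⟨Units.mk0 2 two_ne_zero, 1, 0, 0, 0⟩
    else if i.val = 1 then ⟨1, Units.mk0 2 two_ne_zero, 0, 0, 0⟩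
    else if i.val = 2 then ⟨1, 1, 1, 0, 0⟩
    else ⟨1, 1, 0, 1, 0⟩

end Borel

/-! ### The element `σ` -/

/-- The element `[[x_2, x_3], [x_2, x_4]]`; conjugation by it is `σ`. -/
def sigmaElt (n : ℕ) (hn : 4 ≤ n) : F n :=
  ⁅⁅FreeGroup.of (⟨1, by omega⟩ : Fin n), FreeGroup.of (⟨2, by omega⟩ : Fin n)⁆,
    ⁅FreeGroup.of (⟨1, by omega⟩ : Fin n), FreeGroup.of (⟨3, by omega⟩ : Fin n)⁆⁆

theorem sigma_coe (n : ℕ) (hn : 4 ≤ n) : (sigma n hn).1 = MulAut.conj (sigmaElt n hn) := by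
  simp only [sigmaElt, map_commutatorElement]
  rfl

theorem sigmaElt_mem (n : ℕ) (hn : 4 ≤ n) :
    sigmaElt n hn ∈ ⁅commutator (F n), commutator (F n)⁆ :=
  Subgroup.commutator_mem_commutator
    (Subgroup.commutator_mem_commutator (Subgroup.mem_top _) (Subgroup.mem_top _))
    (Subgroup.commutator_mem_commutator (Subgroup.mem_top _) (Subgroup.mem_top _))

/-- The conjugating element is in F'': its Fox derivatives vanish and its class in H is trivial, so
the product rule leaves those of x_i. -/
theorem sigma_mem_K (n : ℕ) (hn : 4 ≤ n) : sigma n hn ∈ K n := by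
  rw [mem_K_iff]
  intro i j
  have hm := sigmaElt_mem n hn
  have hm' : (sigmaElt n hn)⁻¹ ∈ _ := inv_mem hm
  have hc : cls (sigmaElt n hn) = 1 := cls_eq_one (Subgroup.commutator_le_right _ _ hm)
  rw [sigma_coe, MulAut.conj_apply, foxAb_mul, foxAb_mul, foxAb_eq_zero j hm,
    foxAb_eq_zero j hm', hc, foxAb_of]
  simp

theorem displacement_sigma_ne_one (n : ℕ) (hn : 4 ≤ n) :
    displacement (Borel.rep n) (Borel.commute_map _) (FreeGroup.of ⟨0, by omega⟩)
      ⟨sigma n hn, sigma_mem_K n hn⟩ ≠ 1 := by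
  intro h
  rw [displacement_apply] at h
  have hz := congrArg Borel.z h
  rw [sigma_coe, MulAut.conj_apply] at hz
  simp only [sigmaElt, map_mul, map_inv, map_commutatorElement] at hz
  -- [x_2, x_3] and [x_2, x_4] have entries x = -1/2 and y = 1, so their commutator s has corner
  -- -1/2. Conjugation by x_1 doubles the corner, so s x_1 s⁻¹ x_1⁻¹ has corner -1/2 + 1 = 1/2.
  simp [Borel.rep, commutatorElement_def] at hz
  norm_num at hz

/-! ### Vanishing of σ in IA(W_{n,d})^ab -/

theorem rho_iota_mem_IA {n : ℕ} (d : ℕ) {i : Fin n} (hi : i.val ≠ 0) :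
    rho n d (iota i) ∈ IA (W n d) := by
  have hW : FreeGroup.of i ∈ W n d := by
    simp [W, toCyclic, hi]
  intro w
  -- The conjugating element lies in W_{n,d}, so the restriction is inner there.
  have e : rho n d (iota i) w = ⟨_, hW⟩ * w * (⟨_, hW⟩ : W n d)⁻¹ := rfl
  rw [e, map_mul, map_mul, map_inv, mul_inv_cancel_comm]

/-- The ι_i are not in K_n, but their restrictions are in IA(W_{n,d}); so the commutator expression
for σ becomes available only after restriction. -/
theorem abKtoIA_sigma (n : ℕ) (hn : 4 ≤ n) (d : ℕ) :
    abKtoIA n d (Abelianization.of (⟨sigma n hn, sigma_mem_K n hn⟩ : K n)) = 1 := by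
  let a : IA (W n d) := ⟨_, rho_iota_mem_IA d (i := ⟨1, by omega⟩) one_ne_zero⟩
  let b : IA (W n d) := ⟨_, rho_iota_mem_IA d (i := ⟨2, by omega⟩) two_ne_zero⟩
  let c : IA (W n d) := ⟨_, rho_iota_mem_IA d (i := ⟨3, by omega⟩) three_ne_zero⟩
  have e : KtoIA n d ⟨sigma n hn, sigma_mem_K n hn⟩ = ⁅⁅a, b⁆, ⁅a, c⁆⁆ := by
    ext1
    change rho n d (sigma n hn) = _
    simp only [sigma, map_commutatorElement]
    rfl
  rw [abKtoIA, Abelianization.map_of, e, map_commutatorElement,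
    commutatorElement_eq_one_iff_mul_comm, mul_comm]

end Kouko

end

theorem lemma4p2 (n : ℕ) (hn : 4 ≤ n) :
    ∃ hσ : Kouko.sigma n hn ∈ Kouko.K n,
      Abelianization.of (⟨Kouko.sigma n hn, hσ⟩ : Kouko.K n) ≠ 1 ∧
      ∀ d : ℕ, 2 ≤ d →
        Kouko.abKtoIA n d (Abelianization.of (⟨Kouko.sigma n hn, hσ⟩ : Kouko.K n)) = 1 :=
  ⟨Kouko.sigma_mem_K n hn,
    fun h => Kouko.displacement_sigma_ne_one n hn (Kouko.displacement_eq_one _ _ h),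
    fun d _ => Kouko.abKtoIA_sigma n hn d⟩
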